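/- Let $K$ be a field, let $n\ge 2$, and let $S=K[x_1,\dots,x_{n+1}]$. For a graph $G$ on the vertex set $[n]=\{1,\dots,n\}$, the Hankel edge ideal $I_G\subseteq S$ is the ideal generated by the binomials $g_{ij}=x_ix_{j+1}-x_jx_{i+1}$ with $i<j$ and $\{i,j\}\in E(G)$. For a homogeneous ideal $I\subseteq S$, the ring $S/I$ is called a complete intersection if $\mu(I)=\operatorname{height} I$, where $\mu(I)$ is the minimal number of homogeneous generators of $I$. A tree $T$ on $[n]$ has a rooted labeling, with root $1$, if for every $i\in[n]$ the set of children of $i$ (the neighbors $j$ of $i$ with $j>i$) is $\{t_1+\cdots+t_{i-1}+2,\dots,t_1+\cdots+t_i+1\}$, where $t_k$ is the number of children of $k$; that is, the root gets the label $1$, its neighbors get the next labels, and then, going through the vertices in increasing order, the not yet labeled neighbors of each vertex get the next consecutive labels. Let $T$ be a path on $n$ vertices with a rooted labeling. Then $S/I_T$ is a complete intersection if and only if the root of $T$ is a leaf (a vertex of degree $1$) or a neighbor of a leaf. -/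

import Mathlib

open MvPolynomial

/-- The binomial `g_{ij} = x_i x_{j+1} - x_j x_{i+1}` of `K[x_1, …, x_{n+1}]`. Labels are shifted by
one: the vertex with label `k + 1` is `k : Fin n`, and the variable `x_{k+1}` is `X k` with
`k : Fin (n + 1)`, so for `i : Fin n` the two entries of the `i`-th column of the Hankel matrix
are `X i.castSucc` and `X i.succ`. -/
noncomputable def hankelBinomial (K : Type*) [Field K] {n : ℕ} (i j : Fin n) :
    MvPolynomial (Fin (n + 1)) K :=
  X i.castSucc * X j.succ - X j.castSucc * X i.succ

/-- The Hankel edge ideal of a graph on the vertex set `[n]`, generated by the binomials `g_{ij}`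
with `i < j` and `{i, j}` an edge. -/
noncomputable def hankelEdgeIdeal (K : Type*) [Field K] {n : ℕ} (G : SimpleGraph (Fin n)) :
    Ideal (MvPolynomial (Fin (n + 1)) K) :=
  Ideal.span {f | ∃ i j : Fin n, i < j ∧ G.Adj i j ∧ f = hankelBinomial K i j}

/-- The least cardinality `μ(I)` of a generating set of `I` that consists of homogeneous
polynomials (standard grading); it is `⊤` if there is no finite one. -/
noncomputable def minHomogeneousGenerators {K σ : Type*} [Field K]
    (I : Ideal (MvPolynomial σ K)) : ℕ∞ :=
  ⨅ (s : Set (MvPolynomial σ K))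
    (_ : (∀ f ∈ s, ∃ d : ℕ, f.IsHomogeneous d) ∧ Ideal.span s = I), s.encard

/-- For a homogeneous ideal `I` of the polynomial ring `S`: the ring `S / I` is a complete
intersection, that is, `μ(I) = height I`. -/
def IsCompleteIntersectionQuotient {K σ : Type*} [Field K]
    (I : Ideal (MvPolynomial σ K)) : Prop :=
  minHomogeneousGenerators I = I.height

/-- The children of `i`: the neighbors of `i` whose labels are greater than `i`. -/
def labelChildren {n : ℕ} (T : SimpleGraph (Fin n)) (i : Fin n) : Set (Fin n) :=
  {j | T.Adj i j ∧ i < j}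

/-- The labeling of the tree `T` on `[n]` is a rooted labeling, with the root labeled first
(`0 : Fin n`): going through the vertices in increasing order, the `t_i` children of `i` receive
the consecutive labels that follow those given to the root and to the children of the vertices
before `i`. With labels starting at `1`, the children of `i` are the vertices with labels
`t_1 + ⋯ + t_{i-1} + 2, …, t_1 + ⋯ + t_i + 1`. -/
def IsRootedLabeling {n : ℕ} (T : SimpleGraph (Fin n)) : Prop :=
  ∀ i j : Fin n, j ∈ labelChildren T i ↔
    1 + ∑ k ∈ Finset.Iio i, (labelChildren T k).ncard ≤ (j : ℕ) ∧
      (j : ℕ) < 1 + ∑ k ∈ Finset.Iic i, (labelChildren T k).ncard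

/-- A leaf: a vertex with exactly one neighbor. -/
def IsLeafVertex {V : Type*} (T : SimpleGraph V) (v : V) : Prop :=
  (T.neighborSet v).ncard = 1

/-! Count labels and variables from 0, let `p j` be the parent of `j`, and let f_j = x_{p j} x_{j+1}
- x_j x_{p j + 1} for 1 ≤ j < n. These n - 1 quadrics generate I_T and are needed: since `p` is
monotone, the monomial x_{p j} x_{j+1} occurs in f_j only. So μ = n - 1, and by Krull's height
theorem the question is whether the height reaches n - 1.

If both neighbors of the root have a further neighbor, then `p` starts 0, 0, 1, 2, and f_1, ..., f_4
lie in (x_1, x_2, x_3). Three generators replace four, so the height is at most n - 2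
(`IsPathParent.height_le`).

Otherwise take a minimal prime P over I_T and let Z be the set of k with x_k ∈ P. Primality turns
f_j ∈ P into the relation Z(p j) ∨ Z(j+1) ↔ Z j ∨ Z(p j + 1). These relations force all but two
indices k to satisfy x_k ∈ P, or x_{p(k-1)} ∉ P (`IsNearLeafParent.exists_pair`). In the latter case
f_{k-1} writes x_k modulo P as a fraction in earlier variables. Hence S/P has transcendence degree
at most 2; `card_le_height_of_mul_X_sub_mem` obtains the bound height P ≥ n - 1 from an explicit
chain of primes. -/

/-! ### Combinatorics of rooted labelings of paths -/

/-- In a rooted labeling, parents with larger labels have children with larger labels. -/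
theorem IsRootedLabeling.lt_of_lt {n : ℕ} {T : SimpleGraph (Fin n)} (h : IsRootedLabeling T)
    {i j k l : Fin n} (hj : T.Adj i j) (hij : i < j) (hl : T.Adj k l) (hkl : k < l)
    (hik : i < k) : j < l := by
  have h1 := ((h i j).1 ⟨hj, hij⟩).2
  have h2 := ((h k l).1 ⟨hl, hkl⟩).1
  have h3 : ∑ m ∈ Finset.Iic i, (labelChildren T m).ncard ≤
      ∑ m ∈ Finset.Iio k, (labelChildren T m).ncard :=
    Finset.sum_le_sum_of_subset fun m hm => by
      simp only [Finset.mem_Iic, Finset.mem_Iio] at hm ⊢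
      exact hm.trans_lt hik
  rw [Fin.lt_def]
  omega

/-- The intervals of children of 0, ..., i are consecutive and start at 1, so they cover every
positive label below the end of the last one. -/
theorem IsRootedLabeling.exists_parent_of_lt {n : ℕ} {T : SimpleGraph (Fin n)}
    (h : IsRootedLabeling T) {j : Fin n} (hj : 0 < (j : ℕ)) (i : Fin n)
    (hi : (j : ℕ) < 1 + ∑ k ∈ Finset.Iic i, (labelChildren T k).ncard) :
    ∃ k, T.Adj k j ∧ k < j := by
  obtain ⟨m, hm⟩ := i
  induction m with
  | zero =>
    refine ⟨⟨0, hm⟩, (h _ j).2 ⟨?_, hi⟩⟩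
    rw [show Finset.Iio (⟨0, hm⟩ : Fin n) = ∅ by
      ext x; simp [Fin.lt_def]]
    simp only [Finset.sum_empty]; omega
  | succ m ih =>
    by_cases hlt : 1 + ∑ k ∈ Finset.Iio (⟨m + 1, hm⟩ : Fin n), (labelChildren T k).ncard ≤ (j : ℕ)
    · exact ⟨_, (h _ j).2 ⟨hlt, hi⟩⟩
    · refine ih (by omega) ?_
      rw [show Finset.Iic (⟨m, by omega⟩ : Fin n) = Finset.Iio (⟨m + 1, hm⟩ : Fin n) by
        ext x; simp [Fin.lt_def, Fin.le_def]]
      omega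

/-- In a connected graph with a rooted labeling, every vertex but the root has a parent. -/
theorem IsRootedLabeling.exists_parent {n : ℕ} {T : SimpleGraph (Fin n)}
    (h : IsRootedLabeling T) (hT : T.Preconnected) {j : Fin n} (hj : 0 < (j : ℕ)) :
    ∃ k, T.Adj k j ∧ k < j := by
  obtain ⟨w⟩ := hT ⟨0, by omega⟩ j
  -- A walk from the root to `j` crosses from labels below `j` to labels at least `j`. The crossing
  -- edge shows that the children intervals extend past `j`.
  obtain ⟨d, -, hd1, hd2⟩ := w.exists_boundary_dart {x | x < j} (show (0 : ℕ) < j from hj)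
    (by simp)
  simp only [Set.mem_ofPred_eq, not_lt] at hd1 hd2
  have h1 := ((h d.fst d.snd).1 ⟨d.adj, hd1.trans_le hd2⟩).2
  exact h.exists_parent_of_lt hj d.fst (lt_of_le_of_lt hd2 h1)

theorem SimpleGraph.Iso.eq_of_adj_pathGraph {n : ℕ} {T : SimpleGraph (Fin n)}
    (e : T ≃g SimpleGraph.pathGraph n) {v a b c : Fin n} (ha : T.Adj v a) (hb : T.Adj v b)
    (hc : T.Adj v c) : a = b ∨ a = c ∨ b = c := by
  rw [← e.map_adj_iff, SimpleGraph.pathGraph_adj] at ha hb hc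
  rw [← e.injective.eq_iff, ← e.injective.eq_iff (a := a) (b := c), ← e.injective.eq_iff (a := b) (b := c), Fin.ext_iff, Fin.ext_iff, Fin.ext_iff]
  omega

/-- The parent function of a path with a rooted labeling. -/
structure IsPathParent {n : ℕ} (T : SimpleGraph (Fin n)) (p : ℕ → ℕ) : Prop where
  lt : ∀ j, 0 < j → p j < j
  adj_iff : ∀ i j : Fin n, (T.Adj i j ∧ i < j) ↔ (0 < (j : ℕ) ∧ p j = i)
  mono : ∀ j k, 0 < j → j ≤ k → k < n → p j ≤ p k
  inj : ∀ j k, 0 < j → j < k → k < n → p j = p k → p j = 0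
  root : 3 < n → p 3 ≠ 0

theorem exists_isPathParent {n : ℕ} {T : SimpleGraph (Fin n)}
    (e : T ≃g SimpleGraph.pathGraph n) (h : IsRootedLabeling T) :
    ∃ p, IsPathParent T p := by
  have hT : T.Preconnected := by
    intro u v
    have := (SimpleGraph.pathGraph_preconnected n) (e u) (e v)
    exact e.reachable_iff.1 this
  -- The parent becomes a total function on ℕ; beyond the vertex set only `p j < j` is retained.
  have hex : ∀ j : ℕ, ∃ i : ℕ, (0 < j → i < j) ∧ ∀ hj : j < n, 0 < j →
      ∃ hi : i < n, T.Adj ⟨i, hi⟩ ⟨j, hj⟩ := by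
    intro j
    by_cases hj : j < n ∧ 0 < j
    · obtain ⟨k, hk, hkj⟩ := h.exists_parent hT (j := ⟨j, hj.1⟩) hj.2
      exact ⟨k, fun _ => hkj, fun _ _ => ⟨k.2, hk⟩⟩
    · exact ⟨0, id, fun h1 h2 => absurd ⟨h1, h2⟩ hj⟩
  choose p hp1 hp2 using hex
  have hmono : ∀ j k, 0 < j → j ≤ k → k < n → p j ≤ p k := by
    intro j k hj hjk hk
    by_contra hlt
    obtain ⟨h1, h2⟩ := hp2 j (by omega) hj
    obtain ⟨h3, h4⟩ := hp2 k hk (by omega)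
    have := h.lt_of_lt h4 (hp1 k (by omega)) h2 (hp1 j hj) (not_le.1 hlt)
    simp only [Fin.mk_lt_mk] at this
    omega
  refine ⟨p, hp1, ?_, hmono, ?_, ?_⟩
  · rintro ⟨i, hi⟩ ⟨j, hj⟩
    simp only [Fin.mk_lt_mk]
    constructor
    · rintro ⟨h1, h2⟩
      refine ⟨by omega, ?_⟩
      obtain ⟨h3, h4⟩ := hp2 j hj (by omega)
      rcases lt_trichotomy (p j) i with hlt | heq | hlt
      · exact absurd (h.lt_of_lt h4 (hp1 j (by omega)) h1 h2 hlt) (lt_irrefl _)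
      · exact heq
      · exact absurd (h.lt_of_lt h1 h2 h4 (hp1 j (by omega)) hlt) (lt_irrefl _)
    · rintro ⟨h1, rfl⟩
      exact ⟨(hp2 j hj h1).2, hp1 j h1⟩
  · intro j k hj hjk hk heq
    by_contra h0
    obtain ⟨h1, h2⟩ := hp2 j (by omega) hj
    obtain ⟨h3, h4⟩ := hp2 k hk (by omega)
    obtain ⟨h5, h6⟩ := hp2 (p j) h1 (by omega)
    have h7 := hp1 j hj
    have h8 := hp1 (p j) (by omega)
    have h9 : T.Adj ⟨p j, h1⟩ ⟨k, hk⟩ := by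
      convert h4 using 2
    have := e.eq_of_adj_pathGraph h2 h9 h6.symm
    simp only [Fin.mk.injEq] at this
    omega
  -- By monotonicity 1, 2 and 3 would all be children of the root.
  · intro hn h0
    have h1 := hmono 1 3 (by omega) (by omega) hn
    have h2 := hmono 2 3 (by omega) (by omega) hn
    obtain ⟨_, a1⟩ := hp2 1 (by omega) (by omega)
    obtain ⟨_, a2⟩ := hp2 2 (by omega) (by omega)
    obtain ⟨_, a3⟩ := hp2 3 (by omega) (by omega)
    have e1 : p 1 = 0 := by omega
    have e2 : p 2 = 0 := by omega
    simp only [e1, e2, h0] at a1 a2 a3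
    have := e.eq_of_adj_pathGraph a1 a2 a3
    simp at this

theorem isLeafVertex_iff {V : Type*} (T : SimpleGraph V) (v : V) :
    IsLeafVertex T v ↔ ∃ w, ∀ u, T.Adj v u ↔ u = w := by
  simp [IsLeafVertex, Set.ncard_eq_one, Set.ext_iff]

theorem IsPathParent.adj_parent {n : ℕ} {T : SimpleGraph (Fin n)} {p : ℕ → ℕ}
    (h : IsPathParent T p) {i j : ℕ} (hi : i < n) (hj : j < n) (h0 : 0 < j) (hp : p j = i) :
    T.Adj ⟨i, hi⟩ ⟨j, hj⟩ :=
  ((h.adj_iff _ _).2 ⟨h0, hp⟩).1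

theorem IsPathParent.adj_or {n : ℕ} {T : SimpleGraph (Fin n)} {p : ℕ → ℕ}
    (h : IsPathParent T p) {i j : Fin n} (hij : T.Adj i j) :
    (0 < (j : ℕ) ∧ p j = i) ∨ (0 < (i : ℕ) ∧ p i = j) := by
  rcases lt_trichotomy i j with hlt | rfl | hlt
  · exact Or.inl ((h.adj_iff _ _).1 ⟨hij, hlt⟩)
  · exact absurd hij (T.irrefl)
  · exact Or.inr ((h.adj_iff _ _).1 ⟨hij.symm, hlt⟩)

/-- From some label on, the parent is the predecessor, if this holds once. -/
theorem IsPathParent.eq_pred {n : ℕ} {T : SimpleGraph (Fin n)} {p : ℕ → ℕ}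
    (h : IsPathParent T p) {a : ℕ} (ha : 2 ≤ a) (hpa : p a + 1 = a) :
    ∀ j, a ≤ j → j < n → p j + 1 = j := by
  intro j hj
  induction j, hj using Nat.le_induction with
  | base => exact fun _ => hpa
  | succ j hj ih =>
    intro hjn
    have h1 := ih (by omega)
    have h2 := h.mono j (j + 1) (by omega) (by omega) hjn
    have h3 := h.lt (j + 1) (by omega)
    have h4 := h.inj j (j + 1) (by omega) (by omega) hjn
    omega

/-- The parent functions of the paths whose root is a leaf or a neighbor of a leaf. -/
def IsNearLeafParent (n : ℕ) (p : ℕ → ℕ) : Prop :=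
  (∀ j, 1 ≤ j → j < n → p j + 1 = j) ∨
  (2 < n ∧ p 1 = 0 ∧ p 2 = 0 ∧ ∀ j, 3 ≤ j → j < n → p j + 1 = j) ∨
  (3 < n ∧ p 1 = 0 ∧ p 2 = 0 ∧ p 3 = 1 ∧ ∀ j, 4 ≤ j → j < n → p j + 1 = j)

theorem IsPathParent.isNearLeafParent {n : ℕ} {T : SimpleGraph (Fin n)} {p : ℕ → ℕ}
    (h : IsPathParent T p) (hn : 2 ≤ n)
    (h0 : 0 < n) (hleaf : IsLeafVertex T ⟨0, h0⟩ ∨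
      ∃ v : Fin n, T.Adj ⟨0, h0⟩ v ∧ IsLeafVertex T v) : IsNearLeafParent n p := by
  have p1 : p 1 = 0 := by have := h.lt 1 one_pos; omega
  rcases hn.eq_or_lt with rfl | hn2
  · left; intro j hj hj2; have : j = 1 := by omega
    subst this; omega
  have p2 := h.lt 2 two_pos
  by_cases p2' : p 2 = 1
  · left
    intro j hj hjn
    rcases hj.eq_or_lt with rfl | hj
    · omega
    · exact h.eq_pred (le_refl 2) (by omega) j hj hjn
  have p2 : p 2 = 0 := by omega
  rcases Nat.lt_or_ge 3 n with hn3 | hn3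
  swap
  · right; left; exact ⟨hn2, p1, p2, fun j _ _ => by omega⟩
  have a1 := h.adj_parent (i := 0) (j := 1) (by omega) (by omega) one_pos p1
  have a2 := h.adj_parent (i := 0) (j := 2) (by omega) (by omega) two_pos p2
  by_cases p3 : p 3 = 2
  · right; left
    exact ⟨hn2, p1, p2, h.eq_pred (by omega) (by omega)⟩
  have p3l := h.lt 3 (by omega)
  have p3r := h.root hn3
  have p3 : p 3 = 1 := by omega
  right; right
  refine ⟨hn3, p1, p2, p3, fun j hj hjn => ?_⟩
  have a3 := h.adj_parent (i := 1) (j := 3) (by omega) (by omega) (by omega) p3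
  suffices p 4 + 1 = 4 from h.eq_pred (by omega) this j hj hjn
  have b1 := h.mono 3 4 (by omega) (by omega) (by omega)
  have b2 := h.inj 3 4 (by omega) (by omega) (by omega)
  have b3 := h.lt 4 (by omega)
  -- The only other value is `p 4 = 2`; then 0, 1 and 2 each have two neighbors and no leaf is near
  -- the root.
  by_contra p4
  have p4 : p 4 = 2 := by omega
  have a4 := h.adj_parent (i := 2) (j := 4) (by omega) (by omega) (by omega) p4
  rcases hleaf with hl | ⟨v, hv, hl⟩
  · obtain ⟨w, hw⟩ := (isLeafVertex_iff _ _).1 hl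
    have := ((hw _).1 a1).trans ((hw _).1 a2).symm
    simp at this
  · obtain ⟨w, hw⟩ := (isLeafVertex_iff _ _).1 hl
    have hv0 : v = ⟨1, by omega⟩ ∨ v = ⟨2, by omega⟩ := by
      obtain ⟨v, hvn⟩ := v
      rcases h.adj_or hv with ⟨h0, h1⟩ | ⟨h0, -⟩
      · simp only [Fin.mk.injEq]
        by_contra hne
        simp only at h0 h1
        have := h.mono 3 v (by omega) (by omega) hvn
        omega
      · simp at h0
    rcases hv0 with rfl | rfl
    · have := ((hw _).1 a1.symm).trans ((hw _).1 a3).symm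
      simp at this
    · have := ((hw _).1 a2.symm).trans ((hw _).1 a4).symm
      simp at this

theorem IsPathParent.of_not_near_leaf {n : ℕ} {T : SimpleGraph (Fin n)} {p : ℕ → ℕ}
    (h : IsPathParent T p) (hn : 2 ≤ n)
    (h0 : 0 < n) (hleaf : ¬ (IsLeafVertex T ⟨0, h0⟩ ∨
      ∃ v : Fin n, T.Adj ⟨0, h0⟩ v ∧ IsLeafVertex T v)) :
    4 < n ∧ p 1 = 0 ∧ p 2 = 0 ∧ p 3 = 1 ∧ p 4 = 2 := by
  push Not at hleaf
  obtain ⟨hl0, hl⟩ := hleaf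
  have p1 : p 1 = 0 := by have := h.lt 1 one_pos; omega
  have a1 := h.adj_parent (i := 0) (j := 1) (by omega) (by omega) one_pos p1
  -- a vertex which is not a leaf has a second neighbor
  have second : ∀ v w, T.Adj v w → ¬ IsLeafVertex T v → ∃ u, T.Adj v u ∧ u ≠ w := by
    intro v w hvw hv
    by_contra hcon
    push Not at hcon
    exact hv ((isLeafVertex_iff _ _).2 ⟨w, fun u => ⟨hcon u, fun hu => hu ▸ hvw⟩⟩)
  obtain ⟨⟨u, hu⟩, hau, hu1⟩ := second _ _ a1 hl0
  have hu0 := h.adj_or hau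
  simp only [ne_eq, Fin.mk.injEq, lt_irrefl, false_and, or_false] at hu0 hu1
  have p2 : p 2 = 0 := by have := h.mono 2 u (by omega) (by omega) hu; omega
  have a2 := h.adj_parent (i := 0) (j := 2) (by omega) (by omega) two_pos p2
  obtain ⟨⟨u1, hu1n⟩, hau1, hu1'⟩ := second _ _ a1.symm (hl _ a1)
  have hu1c := h.adj_or hau1
  simp only [ne_eq, Fin.mk.injEq] at hu1c hu1'
  have c1 : u1 ≠ 2 := by rintro rfl; omega
  have c0 : u1 ≠ 1 := by rintro rfl; omega
  have c2 : 3 ≤ u1 := by omega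
  have m1 := h.mono 3 u1 (by omega) (by omega) hu1n
  have m2 := h.root (by omega)
  have p3 : p 3 = 1 := by omega
  obtain ⟨⟨u2, hu2n⟩, hau2, hu2'⟩ := second _ _ a2.symm (hl _ a2)
  have hu2c := h.adj_or hau2
  simp only [ne_eq, Fin.mk.injEq] at hu2c hu2'
  have d1 : u2 ≠ 3 := by rintro rfl; omega
  have d0 : u2 ≠ 1 := by rintro rfl; omega
  have d3 : u2 ≠ 2 := by rintro rfl; omega
  have d2 : 4 ≤ u2 := by omega
  have m3 := h.mono 4 u2 (by omega) (by omega) hu2n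
  have m4 := h.mono 3 4 (by omega) (by omega) (by omega)
  have m5 := h.inj 3 4 (by omega) (by omega) (by omega)
  exact ⟨by omega, p1, p2, p3, by omega⟩

/-! ### Height of a prime from a chain of extended contractions -/

section PartialReduction

variable {K σ : Type*} [Field K]

open Classical in
/-- Substitution of the class of `X i` modulo `P` for the variables `X i` with `i ∈ s`. -/
noncomputable def partialReduction (P : Ideal (MvPolynomial σ K)) (s : Set σ) :
    MvPolynomial σ K →ₐ[K] MvPolynomial σ (MvPolynomial σ K ⧸ P) :=
  aeval fun i => if i ∈ s then C (Ideal.Quotient.mk P (X i)) else X i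

theorem partialReduction_of_mem_supported (P : Ideal (MvPolynomial σ K)) {s : Set σ}
    {f : MvPolynomial σ K} (hf : f ∈ supported K s) :
    partialReduction P s f = C (Ideal.Quotient.mk P f) := by
  let ψ : MvPolynomial σ K →ₐ[K] MvPolynomial σ (MvPolynomial σ K ⧸ P) :=
    (IsScalarTower.toAlgHom K (MvPolynomial σ K ⧸ P) _).comp (Ideal.Quotient.mkₐ K P)
  have h : supported K s ≤ AlgHom.equalizer (partialReduction P s) ψ := by
    refine Algebra.adjoin_le ?_
    rintro _ ⟨i, hi, rfl⟩
    change partialReduction P s (X i) = C (Ideal.Quotient.mk P (X i))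
    simp [partialReduction, hi]
  exact h hf

theorem partialReduction_comp (P : Ideal (MvPolynomial σ K)) {s t : Set σ} (hst : s ⊆ t)
    (f : MvPolynomial σ K) :
    aeval (R := MvPolynomial σ K ⧸ P)
      (fun i => open Classical in if i ∈ t then C (Ideal.Quotient.mk P (X i)) else X i)
      (partialReduction P s f) = partialReduction P t f := by
  have h : ((aeval (R := MvPolynomial σ K ⧸ P)
      (fun i => open Classical in if i ∈ t then C (Ideal.Quotient.mk P (X i)) else
        (X i : MvPolynomial σ (MvPolynomial σ K ⧸ P)))).restrictScalars K).comp
      (partialReduction P s) = partialReduction P t := by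
    ext1 i
    by_cases hs : i ∈ s
    · simp [partialReduction, hs, hst hs]
    · simp [partialReduction, hs]
  exact DFunLike.congr_fun h f

/-- The ideal generated by the intersection of `P` with the polynomials in the variables from
`s`. -/
noncomputable def partialIdeal (P : Ideal (MvPolynomial σ K)) (s : Set σ) :
    Ideal (MvPolynomial σ K) :=
  RingHom.ker (partialReduction P s)

instance (P : Ideal (MvPolynomial σ K)) [P.IsPrime] (s : Set σ) : (partialIdeal P s).IsPrime :=
  RingHom.ker_isPrime _

theorem partialIdeal_mono (P : Ideal (MvPolynomial σ K)) {s t : Set σ} (hst : s ⊆ t) :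
    partialIdeal P s ≤ partialIdeal P t := by
  intro f hf
  rw [partialIdeal, RingHom.mem_ker] at hf ⊢
  rw [← partialReduction_comp P hst, hf, map_zero]

theorem partialIdeal_univ (P : Ideal (MvPolynomial σ K)) : partialIdeal P Set.univ = P := by
  ext f
  rw [partialIdeal, RingHom.mem_ker, partialReduction_of_mem_supported P (by simp),
    map_eq_zero_iff _ (C_injective σ _), Ideal.Quotient.eq_zero_iff_mem]

/-- The witness is `a * X k - b`. Reducing only the variables in `s` leaves `X k` free, with
coefficient the class of `a`, which is nonzero modulo `P`. -/
theorem partialIdeal_lt (P : Ideal (MvPolynomial σ K)) {s t : Set σ} (hst : s ⊆ t)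
    {k : σ} (hks : k ∉ s) (hkt : k ∈ t) {a b : MvPolynomial σ K} (ha : a ∈ supported K s)
    (hb : b ∈ supported K s) (haP : a ∉ P) (hab : a * X k - b ∈ P) :
    partialIdeal P s < partialIdeal P t := by
  refine lt_of_le_of_ne (partialIdeal_mono P hst) fun heq => ?_
  have h1 : a * X k - b ∈ partialIdeal P t := by
    rw [partialIdeal, RingHom.mem_ker, partialReduction_of_mem_supported,
      Ideal.Quotient.eq_zero_iff_mem.2 hab, map_zero]
    exact sub_mem (mul_mem (supported_mono hst ha) (X_mem_supported.2 hkt)) (supported_mono hst hb)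
  rw [← heq, partialIdeal, RingHom.mem_ker, map_sub, map_mul,
    partialReduction_of_mem_supported P ha, partialReduction_of_mem_supported P hb,
    show partialReduction P s (X k) = X k by simp [partialReduction, hks]] at h1
  have h2 := congrArg (coeff (Finsupp.single k 1)) h1
  classical
  rw [coeff_sub, coeff_C_mul, coeff_X, if_pos rfl, coeff_C,
    if_neg (Ne.symm (Finsupp.single_ne_zero.2 one_ne_zero)), mul_one, sub_zero, coeff_zero, Ideal.Quotient.eq_zero_iff_mem] at h2
  exact haP h2

end PartialReduction

/-- The height of a prime ideal `P` is at least the number of variables that modulo `P` are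
quotients of polynomials in the preceding variables. -/
theorem card_le_height_of_mul_X_sub_mem {K : Type*} [Field K] {N : ℕ}
    (P : Ideal (MvPolynomial (Fin N) K)) [P.IsPrime] (A : Finset (Fin N))
    (hA : ∀ k ∈ A, ∃ a ∈ supported K (Set.Iio k), ∃ b ∈ supported K (Set.Iio k),
      a ∉ P ∧ a * X k - b ∈ P) :
    (A.card : ℕ∞) ≤ P.height := by
  -- The primes attached to the first `m` variables increase with `m` and end at `P`; each index in
  -- `A` makes a strict step.
  have key : ∀ m : ℕ, ((A.filter fun k : Fin N => (k : ℕ) < m).card : ℕ∞) ≤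
      (partialIdeal P {k | (k : ℕ) < m}).height := by
    intro m
    induction m with
    | zero => simp
    | succ m ih =>
      have hsub : {k : Fin N | (k : ℕ) < m} ⊆ {k | (k : ℕ) < m + 1} := fun k hk =>
        lt_of_lt_of_le (show (k : ℕ) < m from hk) (Nat.le_succ m)
      by_cases hm : ∃ k ∈ A, (k : ℕ) = m
      · obtain ⟨k, hk, rfl⟩ := hm
        obtain ⟨a, ha, b, hb, haP, hab⟩ := hA k hk
        have hlt := partialIdeal_lt P hsub (k := k) (lt_irrefl (k : ℕ)) (Nat.lt_succ_self (k : ℕ))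
          ha hb haP hab
        refine le_trans ?_ (Ideal.height_add_one_le_of_lt_of_isPrime hlt)
        refine le_trans ?_ (add_le_add_left ih 1)
        rw [show (A.filter fun x : Fin N => (x : ℕ) < k + 1) =
          insert k (A.filter fun x : Fin N => (x : ℕ) < k) by
            ext x
            simp only [Finset.mem_filter, Finset.mem_insert, Fin.ext_iff]
            constructor
            · rintro ⟨h1, h2⟩
              by_cases hx : (x : ℕ) = k
              · exact Or.inl hx
              · exact Or.inr ⟨h1, by omega⟩
            · rintro (h1 | ⟨h1, h2⟩)
              · exact ⟨(Fin.ext h1 : x = k) ▸ hk, by omega⟩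
              · exact ⟨h1, by omega⟩]
        exact_mod_cast Finset.card_insert_le _ _
      · push Not at hm
        refine le_trans (le_of_eq ?_) (ih.trans (Ideal.height_mono (partialIdeal_mono P hsub)))
        congr 2
        refine Finset.filter_congr fun x hx => ?_
        have := hm x hx
        omega
  have h := key N
  rwa [Finset.filter_true_of_mem fun (k : Fin N) _ => k.2,
    show {k : Fin N | (k : ℕ) < N} = Set.univ from Set.eq_univ_of_forall fun k => k.2,
    partialIdeal_univ] at h

/-! ### Bounds on the number of generators -/

theorem Ideal.height_span_le_encard {R : Type*} [CommRing R] [IsNoetherianRing R] {s : Set R}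
    (hs : Ideal.span s ≠ ⊤) : (Ideal.span s).height ≤ s.encard := by
  rcases s.finite_or_infinite with hfin | hinf
  · obtain ⟨J, hJ⟩ := Ideal.nonempty_minimalPrimes hs
    rw [Ideal.height_eq_inf_minimalPrimes, ← hfin.cast_ncard_eq]
    exact (iInf₂_le J hJ).trans (Ideal.height_le_card_of_mem_minimalPrimes_span hfin hJ)
  · simp [hinf.encard_eq]

/-- If an ideal generated by `s` vanishes to second order at the origin and if its elements take
all values at `ι`-many coefficients of quadratic monomials, then `s` has at least `|ι|`
elements. -/
theorem card_le_encard_of_coeff_surjective {K σ ι : Type*} [Field K] [Fintype ι] [DecidableEq ι]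
    {s : Set (MvPolynomial σ K)} (hs : Ideal.span s ≤ idealOfVars σ K ^ 2) (m : ι → σ →₀ ℕ)
    (hm : ∀ i, (m i).degree = 2)
    (h : ∀ i, ∃ f ∈ Ideal.span s, ∀ j, coeff (m j) f = if i = j then 1 else 0) :
    (Fintype.card ι : ℕ∞) ≤ s.encard := by
  rcases s.finite_or_infinite with hfin | hinf
  swap
  · simp [hinf.encard_eq]
  let φ : MvPolynomial σ K →ₗ[K] (ι → K) := LinearMap.pi fun i => lcoeff K (m i)
  have hφ : ∀ f i, φ f i = coeff (m i) f := fun f i => rfl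
  -- As `f` has no terms of degree below 2, only the constant term of `a` affects the quadratic part
  -- of `a * f`. Thus ideal generators become linear generators of the image of `φ`.
  have hmul : ∀ a f, f ∈ Ideal.span s → φ (a * f) = constantCoeff a • φ f := by
    intro a f hf
    have hf2 := (mem_pow_idealOfVars_iff' 2 f).1 (hs hf)
    ext i
    classical
    rw [Pi.smul_apply, smul_eq_mul, hφ, hφ, coeff_mul, Finset.sum_eq_single (0, m i)]
    · rfl
    · rintro ⟨u, v⟩ huv hne
      rw [Finset.HasAntidiagonal.mem_antidiagonal] at huv
      simp only at huv
      have hdeg : u.degree + v.degree = 2 := by rw [← map_add, huv, hm]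
      have hu : u ≠ 0 := by
        rintro rfl
        exact hne (by rw [zero_add] at huv; rw [huv])
      have hu' : u.degree ≠ 0 := by rwa [ne_eq, Finsupp.degree_eq_zero_iff]
      rw [hf2 v (by omega), mul_zero]
    · intro h0
      exact absurd (by simp) h0
  have hspan : ∀ f ∈ Ideal.span s, φ f ∈ Submodule.span K (φ '' s) := by
    intro f hf
    induction hf using Submodule.span_induction with
    | mem x hx => exact Submodule.subset_span ⟨x, hx, rfl⟩
    | zero => simp
    | add x y _ _ hx hy => rw [map_add]; exact add_mem hx hy
    | smul a x hx ih => rw [smul_eq_mul, hmul a x hx]; exact Submodule.smul_mem _ _ ih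
  have htop : Submodule.span K (φ '' s) = ⊤ := by
    rw [eq_top_iff, ← (Pi.basisFun K ι).span_eq, Submodule.span_le]
    rintro _ ⟨i, rfl⟩
    obtain ⟨f, hf, hfi⟩ := h i
    have hfe : φ f = Pi.basisFun K ι i := by
      ext j
      rw [hφ, hfi j, Pi.basisFun_apply, Pi.single_apply]
      simp [eq_comm]
    exact hfe ▸ hspan f hf
  have hfin' : (φ '' s).Finite := hfin.image φ
  have h1 : Fintype.card ι ≤ (φ '' s).ncard := by
    have := finrank_span_finset_le_card (R := K) hfin'.toFinset
    rw [Set.finrank, hfin'.coe_toFinset, htop, finrank_top, Module.finrank_fintype_fun_eq_card,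
      ← Set.ncard_eq_toFinset_card _ hfin'] at this
    exact this
  calc (Fintype.card ι : ℕ∞) ≤ ((φ '' s).ncard : ℕ∞) := by exact_mod_cast h1
    _ = (φ '' s).encard := hfin'.cast_ncard_eq
    _ ≤ s.encard := Set.encard_image_le _ _

/-! ### Which variables can lie in a prime over the ideal -/

/-- Membership in `Z` passes to an interior index from either neighbor, so one member, possibly an
endpoint, spreads in both directions. -/
theorem forall_of_exists_of_iff_neighbors {n c : ℕ} {Z : ℕ → Prop}
    (h : ∀ j, c < j → j < n → ((Z (j - 1) ∨ Z (j + 1)) ↔ Z j))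
    (hex : ∃ k, c ≤ k ∧ k ≤ n ∧ Z k) : ∀ j, c < j → j < n → Z j := by
  obtain ⟨k, hck, hkn, hk⟩ := hex
  have up : ∀ d, k + d < n → c < k + d → Z (k + d) := by
    intro d
    induction d with
    | zero => exact fun _ _ => hk
    | succ d ih =>
      intro h1 h2
      refine (h _ h2 h1).1 (Or.inl ?_)
      rcases Nat.eq_zero_or_pos d with rfl | hd
      · exact hk
      · exact ih (by omega) (by omega)
  have down : ∀ d, c < k - d → k - d < n → Z (k - d) := by
    intro d
    induction d with
    | zero => exact fun _ _ => hk
    | succ d ih =>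
      intro h1 h2
      refine (h _ h1 h2).1 (Or.inr ?_)
      rw [show k - (d + 1) + 1 = k - d by omega]
      rcases Nat.lt_or_ge (k - d) n with hlt | hge
      · exact ih (by omega) hlt
      · rwa [show k - d = k by omega]
  intro j hj hjn
  rcases le_total k j with hkj | hkj
  · have := up (j - k) (by omega) (by omega)
    rwa [show k + (j - k) = j by omega] at this
  · have := down (k - j) (by omega) (by omega)
    rwa [show k - (k - j) = j by omega] at this

/-- The indices `u` and `v` are the variables that may stay free modulo the prime. Their choice
depends on which variables vanish. -/
theorem IsNearLeafParent.exists_pair {n : ℕ} {p : ℕ → ℕ} (hp : IsNearLeafParent n p) (hn : 2 ≤ n)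
    {Z : ℕ → Prop}
    (hZ : ∀ j, 1 ≤ j → j < n → ((Z (p j) ∨ Z (j + 1)) ↔ (Z j ∨ Z (p j + 1)))) :
    ∃ u v, u ≤ n ∧ v ≤ n ∧ ∀ k, k ≤ n → k ≠ u → k ≠ v → Z k ∨ (2 ≤ k ∧ ¬ Z (p (k - 1))) := by
  -- Where the parent is the predecessor, the relation reads `Z (j - 1) ∨ Z (j + 1) ↔ Z j`.
  have tail : ∀ c, (∀ j, c < j → j < n → p j + 1 = j) →
      (∀ j, c < j → j < n → Z j) ∨ ∀ k, c ≤ k → k ≤ n → ¬ Z k := by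
    intro c hc
    by_cases hex : ∃ k, c ≤ k ∧ k ≤ n ∧ Z k
    · refine Or.inl (forall_of_exists_of_iff_neighbors (fun j hj hjn => ?_) hex)
      have h1 := hZ j (by omega) hjn
      have h2 := hc j hj hjn
      rwa [h2, show p j = j - 1 by omega, or_self] at h1
    · push Not at hex
      exact Or.inr hex
  -- the variables beyond a block of indices outside `Z`
  have good : ∀ c, (∀ j, c < j → j < n → p j + 1 = j) → (∀ k, c ≤ k → k ≤ n → ¬ Z k) →
      ∀ k, c + 2 ≤ k → k ≤ n → Z k ∨ (2 ≤ k ∧ ¬ Z (p (k - 1))) := by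
    intro c hc hnZ k hk hkn
    have := hc (k - 1) (by omega) (by omega)
    exact Or.inr ⟨by omega, hnZ _ (by omega) (by omega)⟩
  rcases hp with hp | ⟨hn2, p1, p2, hp⟩ | ⟨hn3, p1, p2, p3, hp⟩
  · rcases tail 0 hp with h | h
    · exact ⟨0, n, by omega, le_rfl, fun k hk h0 h1 => Or.inl (h k (by omega) (by omega))⟩
    · exact ⟨0, 1, by omega, by omega, fun k hk h0 h1 => good 0 hp h k (by omega) hk⟩
  · have e1 := hZ 1 le_rfl (by omega)
    have e2 := hZ 2 (by omega) hn2
    rw [p1] at e1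
    rw [p2] at e2
    norm_num at e1 e2
    by_cases z0 : Z 0
    · have z1 : Z 1 := e1.1 (Or.inl z0)
      rcases tail 2 hp with h | h
      · refine ⟨2, n, by omega, le_rfl, fun k hk h0 h1 => Or.inl ?_⟩
        rcases (by omega : k = 0 ∨ k = 1 ∨ 2 < k) with rfl | rfl | hk2
        exacts [z0, z1, h k hk2 (by omega)]
      · refine ⟨2, 3, by omega, by omega, fun k hk h0 h1 => ?_⟩
        rcases (by omega : k = 0 ∨ k = 1 ∨ 4 ≤ k) with rfl | rfl | hk2
        exacts [Or.inl z0, Or.inl z1, good 2 hp h k hk2 hk]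
    · by_cases hex : ∃ k, 2 ≤ k ∧ k ≤ n ∧ Z k
      · have h : ∀ j, 2 < j → j < n → Z j := (tail 2 hp).resolve_right
          fun hcon => by obtain ⟨k, h1, h2, h3⟩ := hex; exact hcon k h1 h2 h3
        have h23 : Z 2 ∨ Z 3 := by
          rcases (Nat.succ_le_of_lt hn2).eq_or_lt with rfl | hn3
          · obtain ⟨k, h1, h2, h3⟩ := hex
            rcases (by omega : k = 2 ∨ k = 3) with rfl | rfl
            exacts [Or.inl h3, Or.inr h3]
          · exact Or.inr (h 3 (by omega) hn3)
        -- With `Z 0` false the first relation makes `Z 1` and `Z 2` equivalent; the second makes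
        -- one of them true.
        have z12 : Z 1 ∧ Z 2 := by tauto
        refine ⟨0, n, by omega, le_rfl, fun k hk h0 h1 => Or.inl ?_⟩
        rcases (by omega : k = 1 ∨ k = 2 ∨ 2 < k) with rfl | rfl | hk2
        exacts [z12.1, z12.2, h k hk2 (by omega)]
      · push Not at hex
        refine ⟨0, 1, by omega, by omega, fun k hk h0 h1 => ?_⟩
        rcases (by omega : k = 2 ∨ k = 3 ∨ 4 ≤ k) with rfl | rfl | hk2
        · exact Or.inr ⟨le_rfl, by simpa [p1] using z0⟩
        · exact Or.inr ⟨by omega, by simpa [p2] using z0⟩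
        · exact good 2 hp hex k hk2 hk
  · have e1 := hZ 1 le_rfl (by omega)
    have e2 := hZ 2 (by omega) (by omega)
    have e3 := hZ 3 (by omega) hn3
    rw [p1] at e1
    rw [p2] at e2
    rw [p3] at e3
    norm_num at e1 e2 e3
    by_cases hex : ∃ k, 3 ≤ k ∧ k ≤ n ∧ Z k
    · have h : ∀ j, 3 < j → j < n → Z j := (tail 3 hp).resolve_right
        fun hcon => by obtain ⟨k, h1, h2, h3⟩ := hex; exact hcon k h1 h2 h3
      by_cases z0 : Z 0
      · have z1 : Z 1 := e1.1 (Or.inl z0)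
        rcases e3.1 (Or.inl z1) with z3 | z2
        · refine ⟨2, n, by omega, le_rfl, fun k hk h0 h1 => Or.inl ?_⟩
          rcases (by omega : k = 0 ∨ k = 1 ∨ k = 3 ∨ 3 < k) with rfl | rfl | rfl | hk2
          exacts [z0, z1, z3, h k hk2 (by omega)]
        · refine ⟨3, n, by omega, le_rfl, fun k hk h0 h1 => Or.inl ?_⟩
          rcases (by omega : k = 0 ∨ k = 1 ∨ k = 2 ∨ 3 < k) with rfl | rfl | rfl | hk2
          exacts [z0, z1, z2, h k hk2 (by omega)]
      · have h34 : Z 3 ∨ Z 4 := by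
          rcases (Nat.succ_le_of_lt hn3).eq_or_lt with rfl | hn4
          · obtain ⟨k, h1, h2, h3⟩ := hex
            rcases (by omega : k = 3 ∨ k = 4) with rfl | rfl
            exacts [Or.inl h3, Or.inr h3]
          · exact Or.inr (h 4 (by omega) hn4)
        -- With `Z 0` false the first two relations make `Z 1`, `Z 2` and `Z 3` equivalent.
        have z123 : Z 1 ∧ Z 2 ∧ Z 3 := by tauto
        refine ⟨0, n, by omega, le_rfl, fun k hk h0 h1 => Or.inl ?_⟩
        rcases (by omega : k = 1 ∨ k = 2 ∨ k = 3 ∨ 3 < k) with rfl | rfl | rfl | hk2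
        exacts [z123.1, z123.2.1, z123.2.2, h k hk2 (by omega)]
    · push Not at hex
      have n3 := hex 3 (by omega) (by omega)
      by_cases z0 : Z 0
      · have z1 : Z 1 := e1.1 (Or.inl z0)
        have z2 : Z 2 := by tauto
        refine ⟨3, 4, by omega, by omega, fun k hk h0 h1 => ?_⟩
        rcases (by omega : k = 0 ∨ k = 1 ∨ k = 2 ∨ 5 ≤ k) with rfl | rfl | rfl | hk2
        exacts [Or.inl z0, Or.inl z1, Or.inl z2, good 3 hp hex k hk2 hk]
      · have z1 : ¬ Z 1 := by tauto
        refine ⟨0, 1, by omega, by omega, fun k hk h0 h1 => ?_⟩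
        rcases (by omega : k = 2 ∨ k = 3 ∨ k = 4 ∨ 5 ≤ k) with rfl | rfl | rfl | hk2
        · exact Or.inr ⟨le_rfl, by simpa [p1] using z0⟩
        · exact Or.inr ⟨by omega, by simpa [p2] using z0⟩
        · exact Or.inr ⟨by omega, by simpa [p3] using z1⟩
        · exact good 3 hp hex k hk2 hk

/-! ### The binomial generators, and the two height bounds -/

/-- The variable with index `k`, or `0` if there is none. -/
noncomputable def hankelVar (K : Type*) [Field K] (n k : ℕ) : MvPolynomial (Fin (n + 1)) K :=
  if h : k < n + 1 then X ⟨k, h⟩ else 0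

theorem hankelVar_of_lt (K : Type*) [Field K] {n k : ℕ} (h : k < n + 1) :
    hankelVar K n k = X ⟨k, h⟩ := dif_pos h

/-- The Hankel binomial of the edge that joins `j` to its parent. -/
noncomputable def parentBinomial (K : Type*) [Field K] (n : ℕ) (p : ℕ → ℕ) (j : ℕ) :
    MvPolynomial (Fin (n + 1)) K :=
  hankelVar K n (p j) * hankelVar K n (j + 1) - hankelVar K n j * hankelVar K n (p j + 1)

theorem hankelVar_mem_idealOfVars (K : Type*) [Field K] (n k : ℕ) :
    hankelVar K n k ∈ idealOfVars (Fin (n + 1)) K := by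
  unfold hankelVar
  split_ifs
  · exact Ideal.subset_span ⟨_, rfl⟩
  · exact zero_mem _

theorem parentBinomial_mem_sq (K : Type*) [Field K] (n : ℕ) (p : ℕ → ℕ) (j : ℕ) :
    parentBinomial K n p j ∈ idealOfVars (Fin (n + 1)) K ^ 2 := by
  rw [pow_two]
  exact sub_mem
    (Ideal.mul_mem_mul (hankelVar_mem_idealOfVars K n _) (hankelVar_mem_idealOfVars K n _))
    (Ideal.mul_mem_mul (hankelVar_mem_idealOfVars K n _) (hankelVar_mem_idealOfVars K n _))

theorem idealOfVars_ne_top (K σ : Type*) [Field K] : idealOfVars σ K ≠ ⊤ := by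
  intro h
  have h1 : (1 : MvPolynomial σ K) ∈ idealOfVars σ K ^ 1 := by
    rw [h, pow_one]; trivial
  have h2 := (mem_pow_idealOfVars_iff' 1 _).1 h1 0 (by simp)
  simp at h2

theorem hankelVar_isHomogeneous (K : Type*) [Field K] (n k : ℕ) :
    (hankelVar K n k).IsHomogeneous 1 := by
  unfold hankelVar
  split_ifs
  · exact isHomogeneous_X _ _
  · exact isHomogeneous_zero _ _ _

theorem parentBinomial_isHomogeneous (K : Type*) [Field K] (n : ℕ) (p : ℕ → ℕ) (j : ℕ) :
    (parentBinomial K n p j).IsHomogeneous 2 :=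
  ((hankelVar_isHomogeneous K n _).mul (hankelVar_isHomogeneous K n _)).sub
    ((hankelVar_isHomogeneous K n _).mul (hankelVar_isHomogeneous K n _))

section PathParent

variable {n : ℕ} {T : SimpleGraph (Fin n)} {p : ℕ → ℕ}

theorem IsPathParent.hankelEdgeIdeal_eq (K : Type*) [Field K] (h : IsPathParent T p) :
    hankelEdgeIdeal K T = Ideal.span (parentBinomial K n p '' Set.Ico 1 n) := by
  unfold hankelEdgeIdeal
  congr 1
  ext f
  simp only [Set.mem_ofPred_eq, Set.mem_image, Set.mem_Ico]
  have key : ∀ i j : Fin n, p j = i → parentBinomial K n p j = hankelBinomial K i j := by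
    intro i j hij
    have hi := i.2
    have hj := j.2
    rw [parentBinomial, hij, hankelVar_of_lt K (by omega : (i : ℕ) < n + 1),
      hankelVar_of_lt K (by omega : (j : ℕ) + 1 < n + 1),
      hankelVar_of_lt K (by omega : (j : ℕ) < n + 1),
      hankelVar_of_lt K (by omega : (i : ℕ) + 1 < n + 1)]
    rfl
  constructor
  · rintro ⟨i, j, hij, hadj, rfl⟩
    obtain ⟨h1, h2⟩ := (h.adj_iff i j).1 ⟨hadj, hij⟩
    exact ⟨j, ⟨h1, j.2⟩, key i j h2⟩
  · rintro ⟨j, ⟨h1, h2⟩, rfl⟩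
    have h3 := h.lt j h1
    obtain ⟨h4, h5⟩ := (h.adj_iff ⟨p j, by omega⟩ ⟨j, h2⟩).2 ⟨h1, rfl⟩
    exact ⟨_, _, h5, h4, key ⟨p j, by omega⟩ ⟨j, h2⟩ rfl⟩

theorem encard_parentBinomial_image_le (K : Type*) [Field K] (n : ℕ) (p : ℕ → ℕ) (a b : ℕ) :
    (parentBinomial K n p '' Set.Ico a b).encard ≤ ((b - a : ℕ) : ℕ∞) := by
  refine (Set.encard_image_le _ _).trans ?_
  rw [← Finset.coe_Ico, Set.encard_coe_eq_coe_finsetCard, Nat.card_Ico]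

theorem span_parentBinomial_le_sq (K : Type*) [Field K] (n : ℕ) (p : ℕ → ℕ) (s : Set ℕ) :
    Ideal.span (parentBinomial K n p '' s) ≤ idealOfVars (Fin (n + 1)) K ^ 2 := by
  rw [Ideal.span_le]
  rintro _ ⟨j, -, rfl⟩
  exact parentBinomial_mem_sq K n p j

theorem IsPathParent.ne_top (K : Type*) [Field K] (h : IsPathParent T p) :
    hankelEdgeIdeal K T ≠ ⊤ := by
  rw [h.hankelEdgeIdeal_eq K]
  exact ne_top_of_le_ne_top (idealOfVars_ne_top K _)
    ((span_parentBinomial_le_sq K n p _).trans (Ideal.pow_le_self two_ne_zero))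

theorem IsPathParent.minHomogeneousGenerators_le (K : Type*) [Field K] (h : IsPathParent T p) :
    minHomogeneousGenerators (hankelEdgeIdeal K T) ≤ ((n - 1 : ℕ) : ℕ∞) := by
  refine (iInf₂_le (parentBinomial K n p '' Set.Ico 1 n) ⟨?_, (h.hankelEdgeIdeal_eq K).symm⟩).trans
    (encard_parentBinomial_image_le K n p 1 n)
  rintro _ ⟨j, -, rfl⟩
  exact ⟨2, parentBinomial_isHomogeneous K n p j⟩

theorem IsPathParent.height_le_minHomogeneousGenerators (K : Type*) [Field K]
    (h : IsPathParent T p) :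
    (hankelEdgeIdeal K T).height ≤ minHomogeneousGenerators (hankelEdgeIdeal K T) := by
  refine le_iInf₂ fun s hs => ?_
  have := h.ne_top K
  rw [← hs.2] at this ⊢
  exact Ideal.height_span_le_encard this

theorem IsPathParent.le_minHomogeneousGenerators (K : Type*) [Field K] (h : IsPathParent T p) :
    ((n - 1 : ℕ) : ℕ∞) ≤ minHomogeneousGenerators (hankelEdgeIdeal K T) := by
  refine le_iInf₂ fun s hs => ?_
  have hlt : ∀ i : Fin (n - 1), p (i + 1) < n + 1 := fun i => by
    have := h.lt (i + 1) (by omega)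
    omega
  have hcard := card_le_encard_of_coeff_surjective (ι := Fin (n - 1)) (s := s) ?_
    -- The monomial x_{p(i+1)} x_{i+2} of f_{i+1}, the shift by one because `Fin (n - 1)` starts at
    -- 0.
    (fun i => Finsupp.single (⟨p (i + 1), hlt i⟩ : Fin (n + 1)) 1 +
      Finsupp.single ⟨i + 2, by omega⟩ 1) (fun i => by simp) ?_
  · rwa [Fintype.card_fin] at hcard
  · rw [hs.2, h.hankelEdgeIdeal_eq K]
    exact span_parentBinomial_le_sq K n p _
  · intro i
    have hi := i.2
    have hpi := h.lt (i + 1) (by omega)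
    refine ⟨parentBinomial K n p (i + 1), ?_, fun j => ?_⟩
    · rw [hs.2, h.hankelEdgeIdeal_eq K]
      exact Ideal.subset_span ⟨i + 1, ⟨by omega, by omega⟩, rfl⟩
    · have hj := j.2
      have hpj := h.lt (j + 1) (by omega)
      have mono1 := h.mono (i + 1) (j + 1) (by omega)
      have mono2 := h.mono (j + 1) (i + 1) (by omega)
      classical
      rw [parentBinomial, hankelVar_of_lt K (hlt i),
        hankelVar_of_lt K (by omega : (i : ℕ) + 1 + 1 < n + 1),
        hankelVar_of_lt K (by omega : (i : ℕ) + 1 < n + 1),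
        hankelVar_of_lt K (by omega : p ((i : ℕ) + 1) + 1 < n + 1), X, X, X, X,
        monomial_mul, monomial_mul, coeff_sub, coeff_monomial, coeff_monomial]
      refine (congrArg₂ (· - ·) (if_congr (Q := i = j) ?_ (one_mul 1) rfl) (if_neg ?_)).trans
        (sub_zero _)
      · rw [Finsupp.single_add_single_eq_single_add_single one_ne_zero one_ne_zero]
        simp only [Fin.ext_iff]
        constructor
        · omega
        · intro hij
          rw [hij]
          exact Or.inl ⟨rfl, rfl⟩
      · rw [Finsupp.single_add_single_eq_single_add_single one_ne_zero one_ne_zero]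
        simp only [Fin.mk.injEq]
        omega

theorem IsPathParent.le_height (K : Type*) [Field K] (h : IsPathParent T p) (hn : 2 ≤ n)
    (hp : IsNearLeafParent n p) : ((n - 1 : ℕ) : ℕ∞) ≤ (hankelEdgeIdeal K T).height := by
  rw [Ideal.height_eq_inf_minimalPrimes]
  refine le_iInf₂ fun P hP => ?_
  have hprime : P.IsPrime := hP.1.1
  have hIP : ∀ j, 1 ≤ j → j < n → parentBinomial K n p j ∈ P := fun j h1 h2 =>
    hP.1.2 (by rw [h.hankelEdgeIdeal_eq K]; exact Ideal.subset_span ⟨j, ⟨h1, h2⟩, rfl⟩)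
  obtain ⟨u, v, hu, hv, huv⟩ := hp.exists_pair hn (Z := fun k => hankelVar K n k ∈ P)
    (fun j h1 h2 => by
      have := hIP j h1 h2
      rw [← hprime.mul_mem_iff_mem_or_mem, ← hprime.mul_mem_iff_mem_or_mem]
      exact ⟨fun h3 => (Submodule.sub_mem_iff_right _ h3).1 this,
        fun h3 => (Submodule.sub_mem_iff_left _ h3).1 this⟩)
  -- There are n + 1 variables, so at least n - 1 remain after removing the exceptional pair.
  let A : Finset (Fin (n + 1)) := {⟨u, by omega⟩, ⟨v, by omega⟩}ᶜ
  have hA : n - 1 ≤ A.card := by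
    have h2 : ({⟨u, by omega⟩, ⟨v, by omega⟩} : Finset (Fin (n + 1))).card ≤ 2 :=
      Finset.card_le_two
    rw [Finset.card_compl, Fintype.card_fin]
    omega
  refine le_trans (by exact_mod_cast hA) (card_le_height_of_mul_X_sub_mem P A ?_)
  rintro ⟨k, hk⟩ hkA
  simp only [A, Finset.mem_compl, Finset.mem_insert, Finset.mem_singleton, Fin.mk.injEq,
    not_or] at hkA
  rcases huv k (by omega) hkA.1 hkA.2 with hZ | ⟨hk2, hZ⟩
  · refine ⟨1, one_mem _, 0, zero_mem _, fun h1 => hprime.ne_top ((Ideal.eq_top_iff_one P).2 h1),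
      ?_⟩
    rwa [hankelVar_of_lt K hk, ← one_mul (X _), ← sub_zero (1 * X _)] at hZ
  · have hpk := h.lt (k - 1) (by omega)
    have hmem : ∀ i, i < k → hankelVar K n i ∈ supported K (Set.Iio (⟨k, hk⟩ : Fin (n + 1))) := by
      intro i hi
      rw [hankelVar_of_lt K (by omega)]
      exact X_mem_supported.2 (by simpa using hi)
    refine ⟨_, hmem (p (k - 1)) (by omega), _,
      mul_mem (hmem (k - 1) (by omega)) (hmem (p (k - 1) + 1) (by omega)), hZ, ?_⟩
    have := hIP (k - 1) (by omega) (by omega)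
    rwa [parentBinomial, show k - 1 + 1 = k by omega, hankelVar_of_lt K hk] at this

/-- Every term of f_1, ..., f_4 contains x_1, x_2 or x_3, so 3 + (n - 5) elements generate a proper
ideal containing I_T. -/
theorem IsPathParent.height_le (K : Type*) [Field K] (h : IsPathParent T p) (hn : 4 < n)
    (p1 : p 1 = 0) (p2 : p 2 = 0) (p3 : p 3 = 1) (p4 : p 4 = 2) :
    (hankelEdgeIdeal K T).height ≤ ((n - 2 : ℕ) : ℕ∞) := by
  let s : Set (MvPolynomial (Fin (n + 1)) K) :=
    {hankelVar K n 1, hankelVar K n 2, hankelVar K n 3} ∪ parentBinomial K n p '' Set.Ico 5 n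
  have hle : hankelEdgeIdeal K T ≤ Ideal.span s := by
    rw [h.hankelEdgeIdeal_eq K, Ideal.span_le]
    have v1 : hankelVar K n 1 ∈ Ideal.span s := Ideal.subset_span (by simp [s])
    have v2 : hankelVar K n 2 ∈ Ideal.span s := Ideal.subset_span (by simp [s])
    have v3 : hankelVar K n 3 ∈ Ideal.span s := Ideal.subset_span (by simp [s])
    rintro _ ⟨j, ⟨h1, h2⟩, rfl⟩
    rcases (by omega : j = 1 ∨ j = 2 ∨ j = 3 ∨ j = 4 ∨ 5 ≤ j) with rfl | rfl | rfl | rfl | h5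
    · rw [parentBinomial, p1]
      exact sub_mem (Ideal.mul_mem_left _ _ v2) (Ideal.mul_mem_left _ _ v1)
    · rw [parentBinomial, p2]
      exact sub_mem (Ideal.mul_mem_left _ _ v3) (Ideal.mul_mem_left _ _ v1)
    · rw [parentBinomial, p3]
      exact sub_mem (Ideal.mul_mem_right _ _ v1) (Ideal.mul_mem_left _ _ v2)
    · rw [parentBinomial, p4]
      exact sub_mem (Ideal.mul_mem_right _ _ v2) (Ideal.mul_mem_left _ _ v3)
    · exact Ideal.subset_span (Or.inr ⟨j, ⟨h5, h2⟩, rfl⟩)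
  have hs : Ideal.span s ≠ ⊤ := by
    refine ne_top_of_le_ne_top (idealOfVars_ne_top K (Fin (n + 1))) (Ideal.span_le.2 ?_)
    rintro f (hf | ⟨j, -, rfl⟩)
    · simp only [Set.mem_insert_iff, Set.mem_singleton_iff] at hf
      rcases hf with rfl | rfl | rfl <;> exact hankelVar_mem_idealOfVars K n _
    · exact Ideal.pow_le_self two_ne_zero (parentBinomial_mem_sq K n p j)
  calc (hankelEdgeIdeal K T).height ≤ (Ideal.span s).height := Ideal.height_mono hle
    _ ≤ s.encard := Ideal.height_span_le_encard hs
    _ ≤ _ := Set.encard_union_le _ _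
    _ ≤ (3 : ℕ) + ((n - 5 : ℕ) : ℕ∞) := by
      refine add_le_add ?_ (encard_parentBinomial_image_le K n p 5 n)
      refine (Set.encard_insert_le _ _).trans ?_
      rw [show ((3 : ℕ) : ℕ∞) = 1 + 1 + 1 by norm_num]
      refine add_le_add_left ((Set.encard_insert_le _ _).trans ?_) 1
      rw [Set.encard_singleton]
    _ = ((n - 2 : ℕ) : ℕ∞) := by
      rw [← Nat.cast_add]
      congr 1
      omega

end PathParent

theorem theorem3p2 (K : Type*) [Field K] (n : ℕ) (hn : 2 ≤ n) (T : SimpleGraph (Fin n))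
    (hpath : Nonempty (T ≃g SimpleGraph.pathGraph n)) (hroot : IsRootedLabeling T) :
    IsCompleteIntersectionQuotient (hankelEdgeIdeal K T) ↔
      (IsLeafVertex T ⟨0, by omega⟩ ∨
        ∃ v : Fin n, T.Adj ⟨0, by omega⟩ v ∧ IsLeafVertex T v) := by
  obtain ⟨e⟩ := hpath
  obtain ⟨p, hp⟩ := exists_isPathParent e hroot
  constructor
  · intro hci
    by_contra hcon
    obtain ⟨h4, p1, p2, p3, p4⟩ := hp.of_not_near_leaf hn _ hcon
    have h1 := (hp.le_minHomogeneousGenerators K).trans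
      ((le_of_eq hci).trans (hp.height_le K h4 p1 p2 p3 p4))
    rw [Nat.cast_le] at h1
    omega
  · intro hleaf
    exact le_antisymm
      ((hp.minHomogeneousGenerators_le K).trans (hp.le_height K hn (hp.isNearLeafParent hn _ hleaf)))
      (hp.height_le_minHomogeneousGenerators K)
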